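/- Let $B_n(x)$ denote the Bernoulli polynomials, $\sum_{n\ge0}B_n(x)t^n/n!=te^{tx}/(e^t-1)$ for $|t|<2\pi$, and $B_n=B_n(0)$. For an integer $m\ge 0$, $x\in[0,1/2]$ and $t>0$ put $$G_m(x,t)=(-1)^{m-1}\left(\log\frac{\Gamma(t+1-x)\Gamma(t+x)}{\Gamma(t)\Gamma(t+1)}-\sum_{\ell=1}^m\frac{B_{2\ell}(x)-B_{2\ell}}{\ell(2\ell-1)}\frac1{t^{2\ell-1}}\right),$$ $$H_m(x,t)=(-1)^{m}\left(\log\frac{\Gamma(t+1-x)}{t^{1-2x}\Gamma(t+x)}-\sum_{\ell=1}^m\frac{B_{2\ell+1}(x)}{\ell(2\ell+1)}\frac1{t^{2\ell}}\right),$$ where an empty sum is $0$. A function $f$ is called completely monotonic on $(0,\infty)$ if it is infinitely differentiable there and $(-1)^nf^{(n)}(t)\ge 0$ for all $t>0$ and all integers $n\ge 0$. Theorem. For each integer $m\ge 0$ and each $x\in[0,1/2]$, the functions $t\mapsto G_m(x,t)$ and $t\mapsto H_m(x,t)$ are completely monotonic on $(0,\infty)$. In particular, for each integer $m\ge0$,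 Chen's functions $$U_m(t)=(-1)^m\left(\log\frac{\Gamma(t+2/3)}{t^{1/3}\Gamma(t+1/3)}-\sum_{\ell=1}^m\frac{B_{2\ell+1}(1/3)}{\ell(2\ell+1)}\frac1{t^{2\ell}}\right)=H_m(1/3,t),$$ $$V_m(t)=(-1)^m\left(\log\frac{\Gamma(t+3/4)}{t^{1/2}\Gamma(t+1/4)}-\sum_{\ell=1}^m\frac{B_{2\ell+1}(1/4)}{\ell(2\ell+1)}\frac1{t^{2\ell}}\right)=H_m(1/4,t)$$ are completely monotonic on $(0,\infty)$, as Chen conjectured. -/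

import Mathlib

open scoped ContDiff

noncomputable section

namespace GammaRatio

/-- `f` is completely monotonic on the open set `I`: it is infinitely differentiable on `I` and
`(-1) ^ n * f⁽ⁿ⁾(t) ≥ 0` for all `n ≥ 0` and all `t ∈ I`. -/
def CompletelyMonotonicOn (f : ℝ → ℝ) (I : Set ℝ) : Prop :=
  ContDiffOn ℝ ∞ f I ∧ ∀ n : ℕ, ∀ t ∈ I, 0 ≤ (-1 : ℝ) ^ n * iteratedDeriv n f t

/-- `G_m(x,t)`. Here `bernoulliFun n x` is the value `B_n(x)` of the `n`-th Bernoulli polynomial,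
`B_n = B_n(0)`, and the sign `(-1)^(m-1)` is written `(-1)^(m+1)` as `m` is a natural number. -/
def G (m : ℕ) (x t : ℝ) : ℝ :=
  (-1 : ℝ) ^ (m + 1) *
    (Real.log (Real.Gamma (t + 1 - x) * Real.Gamma (t + x) /
        (Real.Gamma t * Real.Gamma (t + 1))) -
      ∑ l ∈ Finset.Icc 1 m,
        (bernoulliFun (2 * l) x - bernoulliFun (2 * l) 0) / ((l : ℝ) * (2 * (l : ℝ) - 1)) *
          (1 / t ^ (2 * l - 1)))

/-- `H_m(x,t)`. -/
def H (m : ℕ) (x t : ℝ) : ℝ :=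
  (-1 : ℝ) ^ m *
    (Real.log (Real.Gamma (t + 1 - x) / (t ^ (1 - 2 * x) * Real.Gamma (t + x))) -
      ∑ l ∈ Finset.Icc 1 m,
        bernoulliFun (2 * l + 1) x / ((l : ℝ) * (2 * (l : ℝ) + 1)) * (1 / t ^ (2 * l)))

/-- Chen's function `U_m(t)`. -/
def U (m : ℕ) (t : ℝ) : ℝ :=
  (-1 : ℝ) ^ m *
    (Real.log (Real.Gamma (t + 2 / 3) / (t ^ (1 / 3 : ℝ) * Real.Gamma (t + 1 / 3))) -
      ∑ l ∈ Finset.Icc 1 m,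
        bernoulliFun (2 * l + 1) (1 / 3) / ((l : ℝ) * (2 * (l : ℝ) + 1)) * (1 / t ^ (2 * l)))

/-- Chen's function `V_m(t)`. -/
def V (m : ℕ) (t : ℝ) : ℝ :=
  (-1 : ℝ) ^ m *
    (Real.log (Real.Gamma (t + 3 / 4) / (t ^ (1 / 2 : ℝ) * Real.Gamma (t + 1 / 4))) -
      ∑ l ∈ Finset.Icc 1 m,
        bernoulliFun (2 * l + 1) (1 / 4) / ((l : ℝ) * (2 * (l : ℝ) + 1)) * (1 / t ^ (2 * l)))

end GammaRatio

end

namespace GammaRatio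

open Real Set Filter Topology

/-- `F 0, F 1, F 2, …` are successive derivatives of each other on `(0, ∞)`. -/
def IsDerivTower (F : ℕ → ℝ → ℝ) : Prop :=
  ∀ n t, 0 < t → HasDerivAt (F n) (F (n + 1) t) t

theorem IsDerivTower.iteratedDeriv_eq {F : ℕ → ℝ → ℝ} (hF : IsDerivTower F) (n : ℕ) {t : ℝ}
    (ht : 0 < t) : iteratedDeriv n (F 0) t = F n t := by
  induction n generalizing t with
  | zero => simp
  | succ n ih =>
    rw [iteratedDeriv_succ]
    have : iteratedDeriv n (F 0) =ᶠ[𝓝 t] F n := by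
      filter_upwards [Ioi_mem_nhds ht] with s hs using ih hs
    rw [this.deriv_eq, (hF n t ht).deriv]

theorem IsDerivTower.eq_of_eqOn {F E : ℕ → ℝ → ℝ} (hF : IsDerivTower F) (hE : IsDerivTower E)
    (h : ∀ t, 0 < t → F 0 t = E 0 t) (n : ℕ) {t : ℝ} (ht : 0 < t) : F n t = E n t := by
  induction n generalizing t with
  | zero => exact h t ht
  | succ n ih =>
    have : F n =ᶠ[𝓝 t] E n := by
      filter_upwards [Ioi_mem_nhds ht] with s hs using ih hs
    exact (hF n t ht).unique ((hE n t ht).congr_of_eventuallyEq this)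

theorem IsDerivTower.contDiffOn {F : ℕ → ℝ → ℝ} (hF : IsDerivTower F) :
    ContDiffOn ℝ ∞ (F 0) (Ioi 0) := by
  rw [contDiffOn_infty]
  intro n
  suffices ∀ k, ContDiffOn ℝ n (F k) (Ioi 0) from this 0
  induction n with
  | zero =>
    intro k
    exact contDiffOn_zero.2 fun t ht => (hF k t ht).continuousAt.continuousWithinAt
  | succ n ih =>
    intro k
    push_cast
    rw [contDiffOn_succ_iff_deriv_of_isOpen isOpen_Ioi]
    refine ⟨fun t ht => (hF k t ht).differentiableAt.differentiableWithinAt, by simp, ?_⟩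
    exact (ih (k + 1)).congr fun t ht => (hF k t ht).deriv

theorem IsDerivTower.completelyMonotonicOn {F : ℕ → ℝ → ℝ} (hF : IsDerivTower F) {f : ℝ → ℝ}
    (hf : ∀ t, 0 < t → f t = F 0 t) (h : ∀ n t, 0 < t → 0 ≤ (-1 : ℝ) ^ n * F n t) :
    CompletelyMonotonicOn f (Ioi 0) := by
  refine ⟨hF.contDiffOn.congr fun t ht => hf t ht, fun n t ht => ?_⟩
  have : f =ᶠ[𝓝 t] F 0 := by
    filter_upwards [Ioi_mem_nhds ht] with s hs using hf s hs
  rw [this.iteratedDeriv_eq, hF.iteratedDeriv_eq n ht]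
  exact h n t ht

/-! ### Derivatives of log and of log Γ, through Euler's product -/

/-- The `n`-th derivative of the logarithm. -/
noncomputable def logDerivs : ℕ → ℝ → ℝ
  | 0, t => log t
  | n + 1, t => (-1) ^ n * n.factorial / t ^ (n + 1)

theorem isDerivTower_logDerivs : IsDerivTower logDerivs := by
  rintro (_ | n) t ht
  · have h : HasDerivAt log (logDerivs (0 + 1) t) t := by
      simpa [logDerivs] using hasDerivAt_log ht.ne'
    exact h
  · have h := ((hasDerivAt_pow (n + 1) t).inv (pow_ne_zero _ ht.ne')).const_mul
      ((-1 : ℝ) ^ n * n.factorial)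
    have e : logDerivs (n + 1) = fun s => (-1 : ℝ) ^ n * n.factorial * (s ^ (n + 1))⁻¹ := by
      funext s
      simp [logDerivs, div_eq_mul_inv]
    rw [e]
    refine h.congr_deriv ?_
    simp only [logDerivs, Nat.factorial_succ]
    push_cast
    have := ht.ne'
    field_simp
    ring

theorem logDerivs_sign (n : ℕ) (t : ℝ) :
    (-1 : ℝ) ^ n * logDerivs (n + 1) t = n.factorial / t ^ (n + 1) := by
  rw [logDerivs, mul_div_assoc, ← mul_assoc, ← mul_pow]
  simp

/-- Successive derivatives of the terms of a series for `log Γ(t) + log t`. -/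
noncomputable def eulerTerm : ℕ → ℕ → ℝ → ℝ
  | 0, k, t => t * (log (k + 1 + 1) - log (k + 1)) - (log (t + (k + 1)) - log (k + 1))
  | 1, k, t => log (k + 1 + 1) - log (k + 1) - logDerivs 1 (t + (k + 1))
  | n + 2, k, t => -logDerivs (n + 2) (t + (k + 1))

theorem hasDerivAt_eulerTerm (n k : ℕ) {t : ℝ} (ht : 0 < t) :
    HasDerivAt (eulerTerm n k) (eulerTerm (n + 1) k t) t := by
  have hpos : 0 < t + (k + 1) := by positivity
  have h (n : ℕ) : HasDerivAt (fun s => logDerivs n (s + (k + 1)))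
      (logDerivs (n + 1) (t + (k + 1))) t :=
    (isDerivTower_logDerivs n _ hpos).comp_add_const t _
  match n with
  | 0 =>
    have := ((hasDerivAt_id t).mul_const (log ((k : ℝ) + 1 + 1) - log (k + 1))).sub
      ((h 0).sub_const (log ((k : ℝ) + 1)))
    rw [one_mul] at this
    exact this
  | 1 => exact (h 1).const_sub _
  | n + 2 => exact (h (n + 2)).neg

/-- Both log(j+1) - log j and 1/(t+j) lie between 1/(R+j) and 1/j, with j = k+1. The bound is only
locally uniform in `t`, so the series is differentiated on bounded intervals the first time. -/
theorem abs_eulerTerm_one_le {R t : ℝ} (hR : 1 ≤ R) (ht : 0 < t) (htR : t < R) (k : ℕ) :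
    ‖eulerTerm 1 k t‖ ≤ R * (1 / ((k : ℝ) + 1) ^ 2) := by
  set j : ℝ := (k : ℝ) + 1 with hj
  have hj0 : 0 < j := by positivity
  have h1 : log (j + 1) - log j ≤ 1 / j := by
    rw [← log_div (by positivity) hj0.ne']
    refine (log_le_sub_one_of_pos (by positivity)).trans (le_of_eq ?_)
    field_simp
    ring
  have h2 : 1 / (j + 1) ≤ log (j + 1) - log j := by
    rw [← log_div (by positivity) hj0.ne']
    refine le_trans (le_of_eq ?_) (one_sub_inv_le_log_of_pos (by positivity))
    field_simp
    ring
  have h3 : 1 / (R + j) ≤ 1 / (t + j) := by gcongr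
  have h4 : 1 / (t + j) ≤ 1 / j := by gcongr; linarith
  have h5 : 1 / (R + j) ≤ 1 / (j + 1) := one_div_le_one_div_of_le (by positivity) (by linarith)
  have h6 : 1 / j - 1 / (R + j) ≤ R * (1 / j ^ 2) := by
    rw [div_sub_div _ _ hj0.ne' (by positivity), mul_one_div, div_le_div_iff₀ (by positivity)
      (by positivity)]
    nlinarith [mul_pos hj0 hj0, mul_nonneg (sq_nonneg R) hj0.le]
  have e : eulerTerm 1 k t = log (j + 1) - log j - 1 / (t + j) := by
    simp [eulerTerm, logDerivs, hj]
  rw [e, Real.norm_eq_abs, abs_le]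
  constructor <;> linarith

theorem abs_eulerTerm_add_two_le (n k : ℕ) {t : ℝ} (ht : 0 < t) :
    ‖eulerTerm (n + 2) k t‖ ≤ (n + 1).factorial * (1 / ((k : ℝ) + 1) ^ 2) := by
  have e : eulerTerm (n + 2) k t =
      -((-1) ^ (n + 1) * ((n + 1).factorial / (t + (k + 1)) ^ (n + 2))) := by
    simp [eulerTerm, logDerivs, mul_div_assoc]
  have hpos : 0 < t + (k + 1) := by positivity
  rw [e, norm_neg, norm_mul, norm_pow, norm_neg, norm_one, one_pow, one_mul,
    Real.norm_of_nonneg (by positivity), mul_one_div]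
  gcongr
  have hk : (0 : ℝ) ≤ k := by positivity
  calc ((k : ℝ) + 1) ^ 2 ≤ (t + (k + 1)) ^ 2 := pow_le_pow_left₀ (by positivity) (by linarith) 2
    _ ≤ (t + (k + 1)) ^ (n + 2) := pow_le_pow_right₀ (by linarith) (by omega)

theorem summable_one_div_add_one_sq : Summable fun k : ℕ => 1 / ((k : ℝ) + 1) ^ 2 := by
  have := (summable_nat_add_iff 1).2 (Real.summable_one_div_nat_pow.2 (one_lt_two))
  simpa using this

theorem summable_eulerTerm_succ (n : ℕ) {t : ℝ} (ht : 0 < t) :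
    Summable fun k => eulerTerm (n + 1) k t := by
  match n with
  | 0 =>
    exact .of_norm_bounded (summable_one_div_add_one_sq.mul_left (t + 1))
      (abs_eulerTerm_one_le (by linarith) ht (by linarith))
  | n + 1 =>
    exact .of_norm_bounded (summable_one_div_add_one_sq.mul_left _)
      fun k => abs_eulerTerm_add_two_le n k ht

theorem summable_eulerTerm_zero {t : ℝ} (ht : 0 < t) : Summable fun k => eulerTerm 0 k t := by
  refine summable_of_summable_hasDerivAt_of_isPreconnected (t := Ioo 0 (t + 2)) (y₀ := 1)
    (summable_one_div_add_one_sq.mul_left (t + 2)) isOpen_Ioo isPreconnected_Ioo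
    (fun k y hy => hasDerivAt_eulerTerm 0 k hy.1)
    (fun k y hy => abs_eulerTerm_one_le (by linarith) hy.1 hy.2 k) ⟨one_pos, by linarith⟩ ?_
    ⟨ht, by linarith⟩
  -- Every term vanishes at the base point 1.
  refine summable_zero.congr fun k => ?_
  simp only [eulerTerm]
  rw [add_comm (1 : ℝ)]
  ring

/-- Successive derivatives of `log Γ(t) + log t`. -/
noncomputable def eulerSum (n : ℕ) (t : ℝ) : ℝ := ∑' k, eulerTerm n k t

theorem isDerivTower_eulerSum : IsDerivTower eulerSum := by
  intro n t ht
  match n with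
  | 0 =>
    exact hasDerivAt_tsum_of_isPreconnected (t := Ioo 0 (t + 1)) (y₀ := t)
      (summable_one_div_add_one_sq.mul_left (t + 1)) isOpen_Ioo isPreconnected_Ioo
      (fun k y hy => hasDerivAt_eulerTerm 0 k hy.1)
      (fun k y hy => abs_eulerTerm_one_le (by linarith) hy.1 hy.2 k) ⟨ht, by linarith⟩
      (summable_eulerTerm_zero ht) ⟨ht, by linarith⟩
  | n + 1 =>
    exact hasDerivAt_tsum_of_isPreconnected (t := Ioi 0) (y₀ := t)
      (summable_one_div_add_one_sq.mul_left _) isOpen_Ioi isPreconnected_Ioi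
      (fun k y hy => hasDerivAt_eulerTerm (n + 1) k hy)
      (fun k y hy => abs_eulerTerm_add_two_le n k hy) ht
      (summable_eulerTerm_succ n ht) ht

theorem eulerSum_zero {t : ℝ} (ht : 0 < t) : eulerSum 0 t = log (Gamma t) + log t := by
  have h1 := (summable_eulerTerm_zero ht).hasSum.tendsto_sum_nat
  -- The partial sums telescope to t log(n+1), whereas the Bohr–Mollerup sequence has t log n; the
  -- correction tends to 0.
  have h2 : Tendsto (fun n : ℕ => BohrMollerup.logGammaSeq t n + log t +
      t * (log (n + 1) - log n)) atTop (𝓝 (log (Gamma t) + log t + t * 0)) :=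
    ((BohrMollerup.tendsto_log_gamma ht).add_const _).add
      (tendsto_log_nat_add_one_sub_log.const_mul t)
  rw [mul_zero, add_zero] at h2
  refine tendsto_nhds_unique (h1.congr fun n => ?_) h2
  have e (n : ℕ) : ∑ k ∈ Finset.range n, eulerTerm 0 k t =
      t * log (n + 1) + log n.factorial - ∑ k ∈ Finset.range n, log (t + (k + 1)) := by
    induction n with
    | zero => simp
    | succ n ih =>
      rw [Finset.sum_range_succ, ih, Finset.sum_range_succ, Nat.factorial_succ, Nat.cast_mul,
        log_mul (by positivity) (by positivity)]
      simp only [eulerTerm]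
      push_cast
      ring
  rw [e, BohrMollerup.logGammaSeq, Finset.sum_range_succ']
  push_cast
  rw [add_zero]
  ring

/-- The `n`-th derivative of `log Γ`. -/
noncomputable def logGammaDerivs (n : ℕ) (t : ℝ) : ℝ := eulerSum n t - logDerivs n t

theorem isDerivTower_logGammaDerivs : IsDerivTower logGammaDerivs := fun n t ht =>
  (isDerivTower_eulerSum n t ht).sub (isDerivTower_logDerivs n t ht)

theorem logGammaDerivs_zero {t : ℝ} (ht : 0 < t) : logGammaDerivs 0 t = log (Gamma t) := by
  simp [logGammaDerivs, eulerSum_zero ht, logDerivs]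

theorem logGammaDerivs_sign (n : ℕ) {t : ℝ} (ht : 0 < t) :
    0 ≤ (-1 : ℝ) ^ n * logGammaDerivs (n + 2) t := by
  have key {s : ℝ} (hs : 0 < s) : 0 ≤ (-1 : ℝ) ^ n * -logDerivs (n + 2) s := by
    have := logDerivs_sign (n + 1) s
    rw [pow_succ] at this
    have h : (-1 : ℝ) ^ n * -logDerivs (n + 2) s = (n + 1).factorial / s ^ (n + 2) := by
      rw [← this]; ring
    rw [h]
    positivity
  have h1 : 0 ≤ (-1 : ℝ) ^ n * eulerSum (n + 2) t := by
    rw [eulerSum, ← tsum_mul_left]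
    exact tsum_nonneg fun k => key (by positivity)
  rw [logGammaDerivs, sub_eq_add_neg, mul_add]
  exact add_nonneg h1 (key ht)

theorem logGammaDerivs_add_one (n : ℕ) {t : ℝ} (ht : 0 < t) :
    logGammaDerivs n (t + 1) = logGammaDerivs n t + logDerivs n t := by
  refine IsDerivTower.eq_of_eqOn (F := fun n t => logGammaDerivs n (t + 1))
    (E := fun n t => logGammaDerivs n t + logDerivs n t) ?_ ?_ ?_ n ht
  · exact fun n t ht => (isDerivTower_logGammaDerivs n (t + 1) (by linarith)).comp_add_const t 1
  · exact fun n t ht => (isDerivTower_logGammaDerivs n t ht).add (isDerivTower_logDerivs n t ht)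
  · intro t ht
    have hG := Gamma_pos_of_pos ht
    rw [logGammaDerivs_zero (by linarith), logGammaDerivs_zero ht, Gamma_add_one ht.ne',
      log_mul ht.ne' hG.ne', logDerivs, add_comm]

/-- `(-1) ^ n * (log Γ)⁽ⁿ⁺¹⁾` is increasing. -/
theorem logGammaDerivs_monotone (n : ℕ) {s t : ℝ} (hs : 0 < s) (hst : s ≤ t) :
    (-1 : ℝ) ^ n * logGammaDerivs (n + 1) s ≤ (-1 : ℝ) ^ n * logGammaDerivs (n + 1) t := by
  have hd (y : ℝ) (hy : 0 < y) :=
    (isDerivTower_logGammaDerivs (n + 1) y hy).const_mul ((-1 : ℝ) ^ n)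
  refine monotoneOn_of_hasDerivWithinAt_nonneg (convex_Ioi 0)
    (fun y hy => (hd y hy).continuousAt.continuousWithinAt)
    (fun y hy => (hd y (interior_subset hy)).hasDerivWithinAt)
    (fun y hy => logGammaDerivs_sign n (interior_subset hy)) hs (hs.trans_le hst) hst

/-! ### The remainders as functions of x -/

/-- The `n`-th `t`-derivative of `log (Γ(t+1-x) / Γ(t+x))` minus the first `M` terms of its
asymptotic expansion. -/
noncomputable def ratioRemainder (M n : ℕ) (x t : ℝ) : ℝ :=
  logGammaDerivs n (t + 1 - x) - logGammaDerivs n (t + x) +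
    ∑ l ∈ Finset.range M,
      2 * bernoulliFun (2 * l + 1) x / (2 * l + 1).factorial * logDerivs (2 * l + n) t

/-- The derivative of `ratioRemainder` with respect to `x`. -/
noncomputable def ratioRemainderDeriv (M n : ℕ) (x t : ℝ) : ℝ :=
  -logGammaDerivs (n + 1) (t + 1 - x) - logGammaDerivs (n + 1) (t + x) +
    ∑ l ∈ Finset.range M,
      2 * bernoulliFun (2 * l) x / (2 * l).factorial * logDerivs (2 * l + n) t

/-- The `n`-th `t`-derivative of `log (Γ(t+1-x) Γ(t+x) / (Γ(t) Γ(t+1)))` minus the first `m` terms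
of its asymptotic expansion. -/
noncomputable def productRemainder (m n : ℕ) (x t : ℝ) : ℝ :=
  logGammaDerivs n (t + 1 - x) + logGammaDerivs n (t + x) -
      (logGammaDerivs n t + logGammaDerivs n (t + 1)) -
    ∑ l ∈ Finset.range m,
      2 * (bernoulliFun (2 * l + 2) x - bernoulliFun (2 * l + 2) 0) / (2 * l + 2).factorial *
        logDerivs (2 * l + 1 + n) t

theorem hasDerivAt_bernoulliFun_div_factorial (k : ℕ) (x : ℝ) :
    HasDerivAt (fun x => 2 * bernoulliFun (k + 1) x / (k + 1).factorial)
      (2 * bernoulliFun k x / k.factorial) x := by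
  refine (((hasDerivAt_bernoulliFun (k + 1) x).const_mul 2).div_const
    ((k + 1).factorial : ℝ)).congr_deriv ?_
  rw [Nat.factorial_succ]
  have := Nat.factorial_ne_zero k
  push_cast
  field_simp

section Reflection

variable {t x : ℝ} (n : ℕ)

theorem hasDerivAt_logGammaDerivs_one_sub (h : 0 < t + 1 - x) :
    HasDerivAt (fun y => logGammaDerivs n (t + 1 - y)) (-logGammaDerivs (n + 1) (t + 1 - x)) x :=
  (isDerivTower_logGammaDerivs n _ h).comp_const_sub (t + 1) x

theorem hasDerivAt_logGammaDerivs_add (h : 0 < t + x) :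
    HasDerivAt (fun y => logGammaDerivs n (t + y)) (logGammaDerivs (n + 1) (t + x)) x :=
  (isDerivTower_logGammaDerivs n _ h).comp_const_add t x

end Reflection

theorem hasDerivAt_ratioRemainder (M n : ℕ) {x t : ℝ} (h1 : 0 < t + 1 - x) (h2 : 0 < t + x) :
    HasDerivAt (fun y => ratioRemainder M n y t) (ratioRemainderDeriv M n x t) x := by
  refine ((hasDerivAt_logGammaDerivs_one_sub n h1).sub
    (hasDerivAt_logGammaDerivs_add n h2)).add ?_
  exact HasDerivAt.fun_sum fun l _ =>
    (hasDerivAt_bernoulliFun_div_factorial (2 * l) x).mul_const _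

theorem hasDerivAt_ratioRemainderDeriv (M n : ℕ) {x t : ℝ} (h1 : 0 < t + 1 - x)
    (h2 : 0 < t + x) :
    HasDerivAt (fun y => ratioRemainderDeriv (M + 1) n y t) (ratioRemainder M (n + 2) x t) x := by
  have hA : HasDerivAt
      (fun y => -logGammaDerivs (n + 1) (t + 1 - y) - logGammaDerivs (n + 1) (t + y))
      (logGammaDerivs (n + 2) (t + 1 - x) - logGammaDerivs (n + 2) (t + x)) x := by
    simpa using (hasDerivAt_logGammaDerivs_one_sub (n + 1) h1).fun_neg.fun_sub
      (hasDerivAt_logGammaDerivs_add (n + 1) h2)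
  refine hA.add ?_
  -- The l = 0 term has B_0 = 1, so it is constant in `x`; dropping it lowers M by one, and shifting
  -- the index raises n by two.
  have e : (fun y => ∑ l ∈ Finset.range (M + 1),
      2 * bernoulliFun (2 * l) y / (2 * l).factorial * logDerivs (2 * l + n) t) =
      fun y => ∑ l ∈ Finset.range M, 2 * bernoulliFun (2 * l + 1 + 1) y /
        (2 * l + 1 + 1).factorial * logDerivs (2 * l + (n + 2)) t + 2 * logDerivs n t := by
    funext y
    rw [Finset.sum_range_succ']
    congr 1
    · refine Finset.sum_congr rfl fun l _ => ?_
      rw [show 2 * (l + 1) + n = 2 * l + (n + 2) by ring, show 2 * (l + 1) = 2 * l + 1 + 1 by ring]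
    · simp
  rw [e]
  exact (HasDerivAt.fun_sum fun l _ =>
    (hasDerivAt_bernoulliFun_div_factorial (2 * l + 1) x).mul_const _).add_const _

theorem bernoulliFun_odd_zero (l : ℕ) : bernoulliFun (2 * (l + 1) + 1) 0 = 0 := by
  rw [bernoulliFun_eval_zero, bernoulli_eq_zero_of_odd ⟨l + 1, rfl⟩ (by omega), Rat.cast_zero]

/-- At least one expansion term is needed: 2 B_1(0) = -1 supplies the -log t that cancels log Γ(t+1)
- log Γ(t). -/
theorem ratioRemainder_zero (M n : ℕ) {t : ℝ} (ht : 0 < t) :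
    ratioRemainder (M + 1) n 0 t = 0 := by
  rw [ratioRemainder, Finset.sum_range_succ', Finset.sum_eq_zero]
  · simp [logGammaDerivs_add_one n ht]
  · intro l _
    simp [bernoulliFun_odd_zero]

theorem ratioRemainder_half (M n : ℕ) (t : ℝ) : ratioRemainder M n (1 / 2) t = 0 := by
  rw [ratioRemainder, Finset.sum_eq_zero, show t + 1 - 1 / 2 = t + 1 / 2 by ring]
  · simp
  · intro l _
    rw [one_div, bernoulliFun_eval_half_eq_zero]
    simp

theorem nonpos_of_hasDerivAt2_nonneg {a b : ℝ} {f f' f'' : ℝ → ℝ}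
    (hf : ∀ x ∈ Icc a b, HasDerivAt f (f' x) x) (hf' : ∀ x ∈ Icc a b, HasDerivAt f' (f'' x) x)
    (hf'' : ∀ x ∈ Icc a b, 0 ≤ f'' x) (ha : f a = 0) (hb : f b = 0) {x : ℝ} (hx : x ∈ Icc a b) :
    f x ≤ 0 := by
  have hc : ConvexOn ℝ (Icc a b) f := convexOn_of_hasDerivWithinAt2_nonneg (convex_Icc a b)
    (fun y hy => (hf y hy).continuousAt.continuousWithinAt)
    (fun y hy => (hf y (interior_subset hy)).hasDerivWithinAt)
    (fun y hy => (hf' y (interior_subset hy)).hasDerivWithinAt)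
    (fun y hy => hf'' y (interior_subset hy))
  have hab : a ≤ b := hx.1.trans hx.2
  have := hc.le_max_of_mem_Icc (left_mem_Icc.2 hab) (right_mem_Icc.2 hab) hx
  simpa [ha, hb] using this

/-- The case M = n = 0 is excluded because log Γ itself is not monotone. -/
theorem ratioRemainder_sign (M n : ℕ) (h : 1 ≤ n + M) {x t : ℝ} (hx : x ∈ Icc (0 : ℝ) (1 / 2))
    (ht : 0 < t) : (-1 : ℝ) ^ (n + M) * ratioRemainder M n x t ≤ 0 := by
  induction M generalizing n x with
  | zero =>
    obtain ⟨n, rfl⟩ : ∃ k, n = k + 1 := ⟨n - 1, by omega⟩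
    -- Here x ≤ 1/2 enters, as t+x ≤ t+1-x.
    have := logGammaDerivs_monotone n (s := t + x) (t := t + 1 - x) (by linarith [hx.1])
      (by linarith [hx.2])
    simp only [ratioRemainder, Finset.range_zero, Finset.sum_empty, add_zero, pow_succ]
    linarith
  | succ M ih =>
    refine nonpos_of_hasDerivAt2_nonneg (a := 0) (b := 1 / 2)
      (f := fun y => (-1 : ℝ) ^ (n + (M + 1)) * ratioRemainder (M + 1) n y t)
      (f' := fun y => (-1 : ℝ) ^ (n + (M + 1)) * ratioRemainderDeriv (M + 1) n y t)
      (f'' := fun y => (-1 : ℝ) ^ (n + (M + 1)) * ratioRemainder M (n + 2) y t)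
      (fun y hy => ?_) (fun y hy => ?_) (fun y hy => ?_) ?_ ?_ hx
    · exact (hasDerivAt_ratioRemainder (M + 1) n (by linarith [hy.2])
        (by linarith [hy.1])).const_mul _
    · exact (hasDerivAt_ratioRemainderDeriv M n (by linarith [hy.2])
        (by linarith [hy.1])).const_mul _
    · have := ih (n + 2) (by omega) hy
      rw [show n + 2 + M = n + (M + 1) + 1 by ring, pow_succ] at this
      linarith
    · simp only [ratioRemainder_zero M n ht, mul_zero]
    · simp only [ratioRemainder_half, mul_zero]

theorem hasDerivAt_productRemainder (m n : ℕ) {x t : ℝ} (h1 : 0 < t + 1 - x) (h2 : 0 < t + x) :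
    HasDerivAt (fun y => productRemainder m n y t) (-ratioRemainder m (n + 1) x t) x := by
  have hS := HasDerivAt.fun_sum (u := Finset.range m) fun l _ =>
    ((hasDerivAt_bernoulliFun_div_factorial (2 * l + 1) x).sub_const
      (2 * bernoulliFun (2 * l + 2) 0 / (2 * l + 2).factorial)).mul_const
      (logDerivs (2 * l + 1 + n) t)
  have := (((hasDerivAt_logGammaDerivs_one_sub n h1).fun_add
    (hasDerivAt_logGammaDerivs_add n h2)).sub_const
      (logGammaDerivs n t + logGammaDerivs n (t + 1))).fun_sub hS
  have e : (fun y => productRemainder m n y t) = fun y =>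
      logGammaDerivs n (t + 1 - y) + logGammaDerivs n (t + y) -
        (logGammaDerivs n t + logGammaDerivs n (t + 1)) -
      ∑ l ∈ Finset.range m, (2 * bernoulliFun (2 * l + 2) y / (2 * l + 2).factorial -
        2 * bernoulliFun (2 * l + 2) 0 / (2 * l + 2).factorial) * logDerivs (2 * l + 1 + n) t := by
    funext y
    simp only [productRemainder, mul_sub, sub_div]
  rw [e]
  refine this.congr_deriv ?_
  simp only [ratioRemainder, add_assoc, add_comm n 1]
  ring

theorem productRemainder_zero (m n : ℕ) (t : ℝ) : productRemainder m n 0 t = 0 := by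
  simp [productRemainder]
  ring

theorem productRemainder_sign (m n : ℕ) {x t : ℝ} (hx : x ∈ Icc (0 : ℝ) (1 / 2)) (ht : 0 < t) :
    0 ≤ (-1 : ℝ) ^ (n + (m + 1)) * productRemainder m n x t := by
  have hd (y : ℝ) (hy : y ∈ Icc (0 : ℝ) (1 / 2)) :=
    (hasDerivAt_productRemainder m n (x := y) (t := t) (by linarith [hy.2])
      (by linarith [hy.1])).const_mul ((-1 : ℝ) ^ (n + (m + 1)))
  have hmono := monotoneOn_of_hasDerivWithinAt_nonneg (convex_Icc (0 : ℝ) (1 / 2))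
    (fun y hy => (hd y hy).continuousAt.continuousWithinAt)
    (fun y hy => (hd y (interior_subset hy)).hasDerivWithinAt)
    (fun y hy => by
      have := ratioRemainder_sign m (n + 1) (by omega) (interior_subset hy) ht
      rw [show n + 1 + m = n + (m + 1) by ring] at this
      linarith)
  have := hmono (left_mem_Icc.2 (by norm_num)) hx hx.1
  simpa only [productRemainder_zero, mul_zero] using this

theorem isDerivTower_ratioRemainder (M : ℕ) {x : ℝ} (hx : x ∈ Icc (0 : ℝ) (1 / 2)) :
    IsDerivTower fun n t => ratioRemainder M n x t := by
  intro n t ht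
  have h1 : 0 < t + (1 - x) := by linarith [hx.2]
  have h2 : 0 < t + x := by linarith [hx.1]
  have := (((isDerivTower_logGammaDerivs n _ h1).comp_add_const t _).fun_sub
    ((isDerivTower_logGammaDerivs n _ h2).comp_add_const t _)).fun_add
      (HasDerivAt.fun_sum (u := Finset.range M) fun l _ =>
        (isDerivTower_logDerivs (2 * l + n) t ht).const_mul
          (2 * bernoulliFun (2 * l + 1) x / (2 * l + 1).factorial))
  simp only [ratioRemainder, add_sub_assoc _ (1 : ℝ) x]
  exact this

theorem isDerivTower_productRemainder (m : ℕ) {x : ℝ} (hx : x ∈ Icc (0 : ℝ) (1 / 2)) :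
    IsDerivTower fun n t => productRemainder m n x t := by
  intro n t ht
  have h1 : 0 < t + (1 - x) := by linarith [hx.2]
  have h2 : 0 < t + x := by linarith [hx.1]
  have h3 : 0 < t + 1 := by linarith
  have := ((((isDerivTower_logGammaDerivs n _ h1).comp_add_const t _).fun_add
    ((isDerivTower_logGammaDerivs n _ h2).comp_add_const t _)).fun_sub
      ((isDerivTower_logGammaDerivs n t ht).fun_add
        ((isDerivTower_logGammaDerivs n _ h3).comp_add_const t _))).fun_sub
      (HasDerivAt.fun_sum (u := Finset.range m) fun l _ =>
        (isDerivTower_logDerivs (2 * l + 1 + n) t ht).const_mul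
          (2 * (bernoulliFun (2 * l + 2) x - bernoulliFun (2 * l + 2) 0) / (2 * l + 2).factorial))
  simp only [productRemainder, add_sub_assoc _ (1 : ℝ) x]
  exact this

/-! ### Identification with G, H, U and V -/

theorem sum_Icc_one_eq_sum_range (f : ℕ → ℝ) (m : ℕ) :
    ∑ l ∈ Finset.Icc 1 m, f l = ∑ l ∈ Finset.range m, f (l + 1) := by
  rw [Finset.sum_bij' (fun l _ => l - 1) (fun l _ => l + 1)] <;> grind

theorem G_eq_productRemainder (m : ℕ) {x t : ℝ} (hx : x ∈ Icc (0 : ℝ) (1 / 2)) (ht : 0 < t) :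
    G m x t = (-1 : ℝ) ^ (m + 1) * productRemainder m 0 x t := by
  have h1 : 0 < t + 1 - x := by linarith [hx.2]
  have h2 : 0 < t + x := by linarith [hx.1]
  have h3 : 0 < t + 1 := by linarith
  have g := @Gamma_pos_of_pos
  rw [G, productRemainder, logGammaDerivs_zero h1, logGammaDerivs_zero h2, logGammaDerivs_zero ht,
    logGammaDerivs_zero h3, log_div (mul_pos (g h1) (g h2)).ne' (mul_pos (g ht) (g h3)).ne',
    log_mul (g h1).ne' (g h2).ne', log_mul (g ht).ne' (g h3).ne', sum_Icc_one_eq_sum_range]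
  congr 2
  refine Finset.sum_congr rfl fun l _ => ?_
  have hf := Nat.factorial_ne_zero (2 * l)
  rw [show 2 * (l + 1) - 1 = 2 * l + 1 by omega, show 2 * (l + 1) = 2 * l + 2 by ring, add_zero,
    logDerivs, Nat.factorial_succ, Nat.factorial_succ, pow_mul]
  push_cast
  have h5 : 2 * ((l : ℝ) + 1) - 1 = 2 * l + 1 := by ring
  rw [h5]
  field_simp
  simp
  ring

theorem H_eq_ratioRemainder (m : ℕ) {x t : ℝ} (hx : x ∈ Icc (0 : ℝ) (1 / 2)) (ht : 0 < t) :
    H m x t = (-1 : ℝ) ^ m * ratioRemainder (m + 1) 0 x t := by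
  have h1 : 0 < t + 1 - x := by linarith [hx.2]
  have h2 : 0 < t + x := by linarith [hx.1]
  have g := @Gamma_pos_of_pos
  have hp := rpow_pos_of_pos ht (1 - 2 * x)
  rw [H, ratioRemainder, logGammaDerivs_zero h1, logGammaDerivs_zero h2,
    log_div (g h1).ne' (mul_pos hp (g h2)).ne', log_mul hp.ne' (g h2).ne', log_rpow ht,
    sum_Icc_one_eq_sum_range, Finset.sum_range_succ']
  -- Even derivatives of log are negative, hence the sign; the split-off l = 0 term, (2x-1) log t,
  -- accounts for the power of `t`.
  have e : ∑ l ∈ Finset.range m, 2 * bernoulliFun (2 * (l + 1) + 1) x /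
      (2 * (l + 1) + 1).factorial * logDerivs (2 * (l + 1) + 0) t =
      -∑ l ∈ Finset.range m, bernoulliFun (2 * (l + 1) + 1) x /
        (((l + 1 : ℕ) : ℝ) * (2 * ((l + 1 : ℕ) : ℝ) + 1)) * (1 / t ^ (2 * (l + 1))) := by
    rw [← Finset.sum_neg_distrib]
    refine Finset.sum_congr rfl fun l _ => ?_
    have hf := Nat.factorial_ne_zero (2 * l)
    rw [show 2 * (l + 1) = 2 * l + 1 + 1 by ring, add_zero, logDerivs, Nat.factorial_succ,
      Nat.factorial_succ (2 * l + 1), pow_succ, pow_mul]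
    push_cast
    have := Nat.factorial_ne_zero (2 * l + 1)
    field_simp
    simp
    ring
  rw [e]
  simp [logDerivs]
  ring

theorem completelyMonotonicOn_G (m : ℕ) {x : ℝ} (hx : x ∈ Icc (0 : ℝ) (1 / 2)) :
    CompletelyMonotonicOn (fun t => G m x t) (Ioi 0) := by
  refine IsDerivTower.completelyMonotonicOn
    (F := fun n t => (-1 : ℝ) ^ (m + 1) * productRemainder m n x t)
    (fun n t ht => (isDerivTower_productRemainder m hx n t ht).const_mul _)
    (fun t ht => G_eq_productRemainder m hx ht) fun n t ht => ?_
  rw [← mul_assoc, ← pow_add]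
  exact productRemainder_sign m n hx ht

theorem completelyMonotonicOn_H (m : ℕ) {x : ℝ} (hx : x ∈ Icc (0 : ℝ) (1 / 2)) :
    CompletelyMonotonicOn (fun t => H m x t) (Ioi 0) := by
  refine IsDerivTower.completelyMonotonicOn
    (F := fun n t => (-1 : ℝ) ^ m * ratioRemainder (m + 1) n x t)
    (fun n t ht => (isDerivTower_ratioRemainder (m + 1) hx n t ht).const_mul _)
    (fun t ht => H_eq_ratioRemainder m hx ht) fun n t ht => ?_
  have := ratioRemainder_sign (m + 1) n (by omega) hx ht
  rw [← add_assoc, pow_succ, pow_add] at this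
  linarith

theorem H_one_third (m : ℕ) : H m (1 / 3) = U m := by
  funext t
  rw [H, U, show t + 1 - 1 / 3 = t + 2 / 3 by ring, show (1 : ℝ) - 2 * (1 / 3) = 1 / 3 by norm_num]

theorem H_one_fourth (m : ℕ) : H m (1 / 4) = V m := by
  funext t
  rw [H, V, show t + 1 - 1 / 4 = t + 3 / 4 by ring, show (1 : ℝ) - 2 * (1 / 4) = 1 / 2 by norm_num]

end GammaRatio

theorem theorem3p4 :
    (∀ (m : ℕ) (x : ℝ), x ∈ Set.Icc (0 : ℝ) (1 / 2) →
      GammaRatio.CompletelyMonotonicOn (fun t : ℝ => GammaRatio.G m x t) (Set.Ioi 0) ∧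
      GammaRatio.CompletelyMonotonicOn (fun t : ℝ => GammaRatio.H m x t) (Set.Ioi 0)) ∧
    (∀ m : ℕ,
      (∀ t : ℝ, 0 < t → GammaRatio.H m (1 / 3) t = GammaRatio.U m t) ∧
      (∀ t : ℝ, 0 < t → GammaRatio.H m (1 / 4) t = GammaRatio.V m t) ∧
      GammaRatio.CompletelyMonotonicOn (GammaRatio.U m) (Set.Ioi 0) ∧
      GammaRatio.CompletelyMonotonicOn (GammaRatio.V m) (Set.Ioi 0)) := by
  refine ⟨fun m x hx => ⟨GammaRatio.completelyMonotonicOn_G m hx,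
    GammaRatio.completelyMonotonicOn_H m hx⟩, fun m => ⟨fun t _ => ?_, fun t _ => ?_, ?_, ?_⟩⟩
  · rw [GammaRatio.H_one_third]
  · rw [GammaRatio.H_one_fourth]
  · rw [← GammaRatio.H_one_third]
    exact GammaRatio.completelyMonotonicOn_H m (by norm_num)
  · rw [← GammaRatio.H_one_fourth]
    exact GammaRatio.completelyMonotonicOn_H m (by norm_num)
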